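/- Let $\mathbb{C}(z)$ be the field of rational functions in one variable and let $A=\mathbb{C}(z)\left[z\frac{d}{dz}\right]$ be the (noncommutative) ring of linear differential operators with coefficients in $\mathbb{C}(z)$, the product being composition of operators. Put $D=z\frac{d}{dz}$ and $$L = D^4-3^6 z\left(D+\tfrac13\right)^2\left(D+\tfrac23\right)^2\in A .$$ Then $L$ is irreducible in $A$: it is not a unit of $A$, and whenever $L=PQ$ with $P,Q\in A$, one of $P,Q$ is a unit of $A$. In particular, there are no $P=a_0+a_1D+\dots+a_mD^m$ and $Q=b_0+b_1D+\dots+b_nD^n$ with $a_i,b_j\in\mathbb{C}(z)$, $a_m\neq0$, $b_n\neq0$, $m,n\ge1$, such that $L=PQ$. -/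

import Mathlib

open Polynomial

noncomputable section

namespace PicardFuchs

/-- The derivative `f ↦ df/dz` on `ℂ(z)`, by the quotient rule applied to the reduced fraction. -/
def ratDeriv (f : RatFunc ℂ) : RatFunc ℂ :=
  algebraMap ℂ[X] (RatFunc ℂ) (derivative f.num * f.denom - f.num * derivative f.denom) /
    algebraMap ℂ[X] (RatFunc ℂ) (f.denom ^ 2)

theorem quotient_rule_wellDefined {n d p q : ℂ[X]} (h : n * q = p * d) :
    (derivative n * d - n * derivative d) * q ^ 2 =
      (derivative p * q - p * derivative q) * d ^ 2 := by
  have h2 := congrArg derivative h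
  simp only [derivative_mul] at h2
  linear_combination (d * q) * h2 - (derivative d * q + d * derivative q) * h

theorem ratDeriv_div (p q : ℂ[X]) (hq : q ≠ 0) :
    ratDeriv (algebraMap ℂ[X] (RatFunc ℂ) p / algebraMap ℂ[X] (RatFunc ℂ) q) =
      algebraMap ℂ[X] (RatFunc ℂ) (derivative p * q - p * derivative q) /
        algebraMap ℂ[X] (RatFunc ℂ) (q ^ 2) := by
  have key : ∀ f : RatFunc ℂ,
      f = algebraMap ℂ[X] (RatFunc ℂ) p / algebraMap ℂ[X] (RatFunc ℂ) q →
      ratDeriv f = algebraMap ℂ[X] (RatFunc ℂ) (derivative p * q - p * derivative q) /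
        algebraMap ℂ[X] (RatFunc ℂ) (q ^ 2) := by
    intro f hf
    have h1 : f.num * q = p * f.denom := (RatFunc.num_mul_eq_mul_denom_iff hq).2 hf
    have hd : algebraMap ℂ[X] (RatFunc ℂ) (f.denom ^ 2) ≠ 0 :=
      RatFunc.algebraMap_ne_zero (pow_ne_zero 2 f.denom_ne_zero)
    have hq2 : algebraMap ℂ[X] (RatFunc ℂ) (q ^ 2) ≠ 0 :=
      RatFunc.algebraMap_ne_zero (pow_ne_zero 2 hq)
    unfold ratDeriv
    rw [div_eq_div_iff hd hq2, ← map_mul, ← map_mul, quotient_rule_wellDefined h1]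
  exact key _ rfl

theorem exists_div (f : RatFunc ℂ) : ∃ p q : ℂ[X], q ≠ 0 ∧
    f = algebraMap ℂ[X] (RatFunc ℂ) p / algebraMap ℂ[X] (RatFunc ℂ) q :=
  ⟨f.num, f.denom, f.denom_ne_zero, (RatFunc.num_div_denom f).symm⟩

theorem ratDeriv_add (f g : RatFunc ℂ) : ratDeriv (f + g) = ratDeriv f + ratDeriv g := by
  obtain ⟨p, q, hq, rfl⟩ := exists_div f
  obtain ⟨r, s, hs, rfl⟩ := exists_div g
  have hq' : algebraMap ℂ[X] (RatFunc ℂ) q ≠ 0 := by simpa using hq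
  have hs' : algebraMap ℂ[X] (RatFunc ℂ) s ≠ 0 := by simpa using hs
  rw [div_add_div _ _ hq' hs', ← map_mul, ← map_mul, ← map_mul, ← map_add,
    ratDeriv_div _ _ (mul_ne_zero hq hs), ratDeriv_div _ _ hq, ratDeriv_div _ _ hs]
  simp only [derivative_mul, map_mul, map_add, map_sub, map_pow]
  field_simp
  ring

theorem ratDeriv_mul (f g : RatFunc ℂ) :
    ratDeriv (f * g) = f * ratDeriv g + g * ratDeriv f := by
  obtain ⟨p, q, hq, rfl⟩ := exists_div f
  obtain ⟨r, s, hs, rfl⟩ := exists_div g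
  have hq' : algebraMap ℂ[X] (RatFunc ℂ) q ≠ 0 := by simpa using hq
  have hs' : algebraMap ℂ[X] (RatFunc ℂ) s ≠ 0 := by simpa using hs
  rw [div_mul_div_comm, ← map_mul, ← map_mul,
    ratDeriv_div _ _ (mul_ne_zero hq hs), ratDeriv_div _ _ hq, ratDeriv_div _ _ hs]
  simp only [derivative_mul, map_mul, map_add, map_sub, map_pow]
  field_simp
  ring

theorem ratDeriv_algebraMap (p : ℂ[X]) :
    ratDeriv (algebraMap ℂ[X] (RatFunc ℂ) p) =
      algebraMap ℂ[X] (RatFunc ℂ) (derivative p) := by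
  simpa using ratDeriv_div p 1 one_ne_zero

theorem ratDeriv_smul (c : ℂ) (f : RatFunc ℂ) : ratDeriv (c • f) = c • ratDeriv f := by
  have h : algebraMap ℂ (RatFunc ℂ) c = algebraMap ℂ[X] (RatFunc ℂ) (C c) := by
    rw [IsScalarTower.algebraMap_apply ℂ ℂ[X] (RatFunc ℂ), Polynomial.algebraMap_eq]
  rw [Algebra.smul_def, Algebra.smul_def, ratDeriv_mul, h, ratDeriv_algebraMap]
  simp

/-- The derivation `d/dz` of `ℂ(z)` over `ℂ`. -/
def ddz : Derivation ℂ (RatFunc ℂ) (RatFunc ℂ) :=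
  Derivation.mk' { toFun := ratDeriv, map_add' := ratDeriv_add, map_smul' := ratDeriv_smul }
    ratDeriv_mul

/-- Multiplication by a rational function, as an operator on `ℂ(z)`. -/
def mulOp : RatFunc ℂ →ₐ[ℂ] Module.End ℂ (RatFunc ℂ) := Algebra.lmul ℂ (RatFunc ℂ)

/-- The operator `z d/dz` on `ℂ(z)`. -/
def eulerOp : Module.End ℂ (RatFunc ℂ) :=
  mulOp RatFunc.X * (ddz : RatFunc ℂ →ₗ[ℂ] RatFunc ℂ)

/-- The ring `ℂ(z)[z d/dz]` of differential operators with coefficients in `ℂ(z)`, the product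
being composition. (A differential operator in characteristic zero is determined by its action
on `ℂ(z)`.) -/
def diffOps : Subalgebra ℂ (Module.End ℂ (RatFunc ℂ)) :=
  Algebra.adjoin ℂ (Set.range mulOp ∪ {eulerOp})

/-- A rational function, as a differential operator of order zero. -/
def coeffOp (f : RatFunc ℂ) : diffOps :=
  ⟨mulOp f, Algebra.subset_adjoin (Or.inl ⟨f, rfl⟩)⟩

/-- The differential operator `D = z d/dz`. -/
def D : diffOps := ⟨eulerOp, Algebra.subset_adjoin (Or.inr rfl)⟩

/-- `P = a₀ + a₁ D + ⋯ + aₙ Dⁿ` with rational functions `aᵢ` and `aₙ ≠ 0`. -/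
def HasOrder (P : diffOps) (n : ℕ) : Prop :=
  ∃ a : ℕ → RatFunc ℂ, a n ≠ 0 ∧ P = ∑ i ∈ Finset.range (n + 1), coeffOp (a i) * D ^ i

/-- `L = D⁴ - 3⁶ z (D + 1/3)² (D + 2/3)²`. -/
def L : diffOps :=
  D ^ 4 - coeffOp (3 ^ 6 * RatFunc.X) * (D + algebraMap ℂ diffOps (1 / 3)) ^ 2 *
    (D + algebraMap ℂ diffOps (2 / 3)) ^ 2

end PicardFuchs

end

/-! The proof is a Fuchs relation argument. In a local parameter `t` an operator sends `t ^ s + ⋯`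
to `χ(s) t ^ (s + v) + ⋯` with a polynomial `χ`, whose roots are the local exponents. For `L` the
exponents are 0, 0, 0, 0 at 0; 1/3, 1/3, 2/3, 2/3 at infinity; 0, 1, 1, 2 at 1/729; and 0, 1, 2, 3
at every other point. In each case `χ` has the full degree 4.

Let `L = P Q` with `Q` monic of order `n + 1`, where `0 ≤ n ≤ 2`, and let `f` be the coefficient of
`D ^ n` in `Q`. The symbol of `Q` divides that of `L`, and a degree count shows that it also has
full degree. Hence the exponents of `Q` form a submultiset of those of `L`, and Vieta expresses
their sum through the leading local coefficient of `f` (`exists_exponents`). It follows that `f dz /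
z` has at most simple poles at finite points, residue 0 at 0, and residue `n(n+1)/2 - (sum of
exponents)` at any other finite point. At infinity `f` takes the sum of the exponents there as its
value.

The residue theorem (`exists_sum_residues_div`) equates `f(∞)` with the sum of the finite residues.
Now `f(∞) ≥ (n+1)/2 - 1/3`, while the residue is at most `n(n-1)/2` at 1/729 and at most 0
elsewhere. This fails for `n = 0, 1, 2`. -/

noncomputable section

namespace PicardFuchs

/-! ### Leading terms of Laurent series -/

/-- The Laurent series `x` has no terms of degree less than `a`. -/
def VanishBelow (a : ℤ) (x : LaurentSeries ℂ) : Prop := ∀ k < a, x.coeff k = 0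

theorem VanishBelow.mono {a b : ℤ} {x : LaurentSeries ℂ} (h : VanishBelow a x) (hb : b ≤ a) :
    VanishBelow b x := fun k hk => h k (lt_of_lt_of_le hk hb)

theorem VanishBelow.add {a : ℤ} {x y : LaurentSeries ℂ} (hx : VanishBelow a x)
    (hy : VanishBelow a y) : VanishBelow a (x + y) := fun k hk => by
  rw [HahnSeries.coeff_add, hx k hk, hy k hk, add_zero]

theorem VanishBelow.mul {a b : ℤ} {x y : LaurentSeries ℂ} (hx : VanishBelow a x)
    (hy : VanishBelow b y) : VanishBelow (a + b) (x * y) := by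
  intro k hk
  rw [HahnSeries.coeff_mul]
  refine Finset.sum_eq_zero fun ij hij => ?_
  rw [Finset.mem_antidiagonal] at hij
  rcases lt_or_ge ij.1 a with h | h
  · rw [hx _ h, zero_mul]
  · rw [hy ij.2 (by omega), mul_zero]

theorem VanishBelow.coeff_mul {a b : ℤ} {x y : LaurentSeries ℂ} (hx : VanishBelow a x)
    (hy : VanishBelow b y) : (x * y).coeff (a + b) = x.coeff a * y.coeff b := by
  rw [HahnSeries.coeff_mul, Finset.sum_eq_single (a, b)]
  · intro ij hij hne
    rw [Finset.mem_antidiagonal] at hij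
    rcases lt_or_ge ij.1 a with h | h
    · rw [hx _ h, zero_mul]
    · rcases lt_or_ge ij.2 b with h' | h'
      · rw [hy _ h', mul_zero]
      · exact absurd (Prod.ext (by simp; omega) (by simp; omega)) hne
  · intro h
    by_contra hne
    apply h
    rw [Finset.mem_antidiagonal]
    exact ⟨left_ne_zero_of_mul hne, right_ne_zero_of_mul hne, rfl⟩

theorem vanishBelow_order (x : LaurentSeries ℂ) : VanishBelow x.order x :=
  fun _ hk => HahnSeries.coeff_eq_zero_of_lt_order hk

theorem vanishBelow_single (a : ℤ) (c : ℂ) : VanishBelow a (HahnSeries.single a c) :=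
  fun _ hk => HahnSeries.coeff_single_of_ne hk.ne

/-- The Euler derivation `t d/dt` on Laurent series. -/
def laurentEuler (x : LaurentSeries ℂ) : LaurentSeries ℂ where
  coeff k := k * x.coeff k
  isPWO_support' := x.isPWO_support.mono fun k hk h => hk (by simp [h])

@[simp]
theorem coeff_laurentEuler (x : LaurentSeries ℂ) (k : ℤ) :
    (laurentEuler x).coeff k = k * x.coeff k := rfl

theorem laurentEuler_add (x y : LaurentSeries ℂ) :
    laurentEuler (x + y) = laurentEuler x + laurentEuler y := by
  ext k
  simp [mul_add]

theorem laurentEuler_single (a : ℤ) (c : ℂ) :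
    laurentEuler (HahnSeries.single a c) = HahnSeries.single a (a * c) := by
  ext k
  rcases eq_or_ne k a with rfl | h
  · simp
  · simp [h]

theorem laurentEuler_mul (x y : LaurentSeries ℂ) :
    laurentEuler (x * y) = x * laurentEuler y + y * laurentEuler x := by
  have hs : ∀ z : LaurentSeries ℂ, (laurentEuler z).support ⊆ z.support :=
    fun z k hk h => hk (by simp [h])
  ext k
  rw [mul_comm y, HahnSeries.coeff_add, coeff_laurentEuler, HahnSeries.coeff_mul,
    HahnSeries.coeff_mul_left' x.isPWO_support (hs x),
    HahnSeries.coeff_mul_right' y.isPWO_support (hs y), Finset.mul_sum, ← Finset.sum_add_distrib]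
  refine Finset.sum_congr rfl fun ij hij => ?_
  rw [Finset.mem_antidiagonal] at hij
  simp only [coeff_laurentEuler, ← hij.2.2]
  push_cast
  ring

/-! ### Expansions of rational functions and symbols of operators -/

/-- `z d/dz` corresponds to `w · t d/dt` under an expansion of rational functions in `t`, as soon
as it does so on the function `z`. -/
theorem map_eulerOp {ι : RatFunc ℂ →+* LaurentSeries ℂ} {w : LaurentSeries ℂ}
    (hι : ∀ c, ι (algebraMap ℂ _ c) = HahnSeries.C c) (hw : ι RatFunc.X = w * laurentEuler (ι RatFunc.X)) (f : RatFunc ℂ) :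
    ι (eulerOp f) = w * laurentEuler (ι f) := by
  have happ : ∀ g, eulerOp g = RatFunc.X * ratDeriv g := fun g => rfl
  have hmul : ∀ g h, eulerOp (g * h) = g * eulerOp h + h * eulerOp g := fun g h => by
    rw [happ, happ, happ, ratDeriv_mul]; ring
  have hC : ∀ c : ℂ, ι (eulerOp (algebraMap ℂ[X] (RatFunc ℂ) (C c))) =
      w * laurentEuler (ι (algebraMap ℂ[X] (RatFunc ℂ) (C c))) := by
    intro c
    have h1 : algebraMap ℂ[X] (RatFunc ℂ) (C c) = algebraMap ℂ (RatFunc ℂ) c := by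
      rw [IsScalarTower.algebraMap_apply ℂ ℂ[X] (RatFunc ℂ), Polynomial.algebraMap_eq]
    have h2 : laurentEuler (ι (algebraMap ℂ[X] (RatFunc ℂ) (C c))) = 0 := by
      rw [h1, hι, HahnSeries.C_apply, laurentEuler_single]
      simp
    rw [h2, happ, ratDeriv_algebraMap]
    simp
  have hX : ι (eulerOp (algebraMap ℂ[X] (RatFunc ℂ) X)) =
      w * laurentEuler (ι (algebraMap ℂ[X] (RatFunc ℂ) X)) := by
    rw [happ, ratDeriv_algebraMap, RatFunc.algebraMap_X, derivative_X, map_one, mul_one, ← hw]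
  have hprod : ∀ g h, ι (eulerOp g) = w * laurentEuler (ι g) →
      ι (eulerOp h) = w * laurentEuler (ι h) →
      ι (eulerOp (g * h)) = w * laurentEuler (ι (g * h)) := by
    intro g h hg hh
    rw [hmul, map_add, map_mul, map_mul, map_mul, laurentEuler_mul, hg, hh]
    ring
  have hpoly : ∀ p : ℂ[X], ι (eulerOp (algebraMap ℂ[X] (RatFunc ℂ) p)) =
      w * laurentEuler (ι (algebraMap ℂ[X] (RatFunc ℂ) p)) := by
    intro p
    induction p using Polynomial.induction_on with
    | C c => exact hC c
    | add p q hp hq => rw [map_add, map_add, map_add, map_add, laurentEuler_add, hp, hq, mul_add]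
    | monomial n c ih => rw [pow_succ, ← mul_assoc, map_mul]; exact hprod _ _ ih hX
  obtain ⟨p, q, hq, rfl⟩ := exists_div f
  set P := algebraMap ℂ[X] (RatFunc ℂ) p with hP
  set Q := algebraMap ℂ[X] (RatFunc ℂ) q with hQ
  have hQ0 : Q ≠ 0 := RatFunc.algebraMap_ne_zero hq
  have hPQ : P / Q * Q = P := div_mul_cancel₀ _ hQ0
  have h1 := hpoly p
  -- The rule for the polynomial `P = (P / Q) * Q` is expanded by Leibniz on both sides. With the
  -- rule for `Q` it leaves `ι Q` times the desired identity.
  rw [← hP, ← hPQ, hmul, map_add, map_mul, map_mul, map_mul, laurentEuler_mul, hpoly q] at h1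
  have hι : ι Q ≠ 0 := (map_ne_zero ι).2 hQ0
  apply mul_left_cancel₀ hι
  linear_combination h1

/-- The operator `T` maps a function `a t ^ s + ⋯` to `χ(s) a t ^ (s + v) + ⋯`. -/
def HasSymbol (ι : RatFunc ℂ →+* LaurentSeries ℂ) (T : Module.End ℂ (RatFunc ℂ)) (v : ℤ)
    (χ : ℂ[X]) : Prop :=
  ∀ f s, VanishBelow s (ι f) →
    VanishBelow (v + s) (ι (T f)) ∧ (ι (T f)).coeff (v + s) = χ.eval (s : ℂ) * (ι f).coeff s

namespace HasSymbol

variable {ι : RatFunc ℂ →+* LaurentSeries ℂ} {S T : Module.End ℂ (RatFunc ℂ)} {v w : ℤ}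
  {χ ψ : ℂ[X]}

/-- Zero symbols are allowed so that terms of different degrees can be added in the lowest degree.
Only `unique` needs nonzero symbols. -/
theorem lower (h : HasSymbol ι T v χ) (hw : w < v) : HasSymbol ι T w 0 := fun f s hf =>
  ⟨(h f s hf).1.mono (by omega), by rw [(h f s hf).1 _ (by omega)]; simp⟩

theorem add (hS : HasSymbol ι S v χ) (hT : HasSymbol ι T v ψ) :
    HasSymbol ι (S + T) v (χ + ψ) := fun f s hf => by
  obtain ⟨h1, h2⟩ := hS f s hf
  obtain ⟨h3, h4⟩ := hT f s hf
  rw [LinearMap.add_apply, map_add]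
  exact ⟨h1.add h3, by rw [HahnSeries.coeff_add, h2, h4, eval_add, add_mul]⟩

theorem sum {α : Type*} (s : Finset α) (T : α → Module.End ℂ (RatFunc ℂ)) (χ : α → ℂ[X])
    (h : ∀ i ∈ s, HasSymbol ι (T i) v (χ i)) : HasSymbol ι (∑ i ∈ s, T i) v (∑ i ∈ s, χ i) := by
  classical
  induction s using Finset.induction_on with
  | empty => exact fun f s hf => by simp [VanishBelow]
  | insert a s ha ih =>
    rw [Finset.sum_insert ha, Finset.sum_insert ha]
    exact (h a (by simp)).add (ih fun i hi => h i (Finset.mem_insert_of_mem hi))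

/-- `T` moves the leading exponent from `s` to `s + w` before `S` acts. The symbol of the right
factor enters unshifted, so its exponents are exponents of the product. -/
theorem mul (hS : HasSymbol ι S v χ) (hT : HasSymbol ι T w ψ) :
    HasSymbol ι (S * T) (v + w) (χ.comp (X + C (w : ℂ)) * ψ) := fun f s hf => by
  obtain ⟨h1, h2⟩ := hT f s hf
  obtain ⟨h3, h4⟩ := hS _ _ h1
  rw [Module.End.mul_apply, add_assoc]
  refine ⟨h3, ?_⟩
  rw [h4, h2]
  simp only [eval_mul, eval_comp, eval_add, eval_X, eval_C]
  push_cast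
  rw [add_comm (s : ℂ)]
  ring

theorem mulOp {a : RatFunc ℂ} (h : VanishBelow v (ι a)) :
    HasSymbol ι (mulOp a) v (C ((ι a).coeff v)) := fun f s hf => by
  have : PicardFuchs.mulOp a f = a * f := rfl
  rw [this, map_mul]
  exact ⟨h.mul hf, by rw [h.coeff_mul hf, eval_C]⟩

theorem one : HasSymbol ι 1 0 1 := fun f s hf => by
  rw [Module.End.one_apply, zero_add, eval_one, one_mul]
  exact ⟨hf, rfl⟩

theorem const (hι : ∀ c, ι (algebraMap ℂ _ c) = HahnSeries.C c) (c : ℂ) :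
    HasSymbol ι (algebraMap ℂ _ c) 0 (C c) := fun f s hf => by
  have h := vanishBelow_single 0 c
  rw [Module.algebraMap_end_apply, Algebra.smul_def, map_mul, hι, eval_C, HahnSeries.C_apply]
  exact ⟨h.mul hf, by rw [h.coeff_mul hf, HahnSeries.coeff_single_same]⟩

theorem congr (h : HasSymbol ι T v χ) (hv : v = w) (hχ : χ = ψ) : HasSymbol ι T w ψ := by
  subst hv hχ; exact h

theorem eulerOp {u : LaurentSeries ℂ}
    (hι : ∀ c, ι (algebraMap ℂ _ c) = HahnSeries.C c) (hu : ι RatFunc.X = u * laurentEuler (ι RatFunc.X))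
    (h : VanishBelow v u) : HasSymbol ι eulerOp v (C (u.coeff v) * X) := fun f s hf => by
  have h2 : VanishBelow s (laurentEuler (ι f)) := fun k hk => by
    rw [coeff_laurentEuler, hf k hk, mul_zero]
  rw [map_eulerOp hι hu]
  refine ⟨h.mul h2, ?_⟩
  rw [h.coeff_mul h2, coeff_laurentEuler, eval_mul, eval_C, eval_X, mul_assoc]

/-- Nonzero symbols are unique. -/
theorem unique (hι : ∃ t, ι t = HahnSeries.single 1 1) (hT : HasSymbol ι T v χ)
    (hT' : HasSymbol ι T w ψ) (hχ : χ ≠ 0) (hψ : ψ ≠ 0) : v = w ∧ χ = ψ := by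
  obtain ⟨t, ht⟩ := hι
  -- The test functions are the powers of a parameter. They give the value of a symbol at every
  -- integer, and this determines a polynomial.
  have key : ∀ s : ℤ, ∃ f, VanishBelow s (ι f) ∧ (ι f).coeff s = 1 := fun s => by
    refine ⟨t ^ s, ?_⟩
    rw [map_zpow₀, ht, ← RatFunc.single_zpow]
    exact ⟨vanishBelow_single s 1, HahnSeries.coeff_single_same s 1⟩
  have hinf : ∀ p : ℂ[X], (∀ s : ℤ, p.eval (s : ℂ) = 0) → p = 0 := fun p hp =>
    Polynomial.eq_zero_of_infinite_isRoot p
      ((Set.infinite_range_of_injective Int.cast_injective).mono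
        (by rintro _ ⟨s, rfl⟩; exact hp s))
  have hle : ∀ {v w : ℤ} {χ ψ : ℂ[X]}, HasSymbol ι T v χ → HasSymbol ι T w ψ → χ ≠ 0 →
      w ≤ v := by
    intro v w χ ψ h1 h2 h3
    by_contra! hlt
    refine h3 (hinf _ fun s => ?_)
    obtain ⟨f, hf, hf1⟩ := key s
    have := (h1 f s hf).2
    rwa [(h2 f s hf).1 _ (by omega), hf1, mul_one, eq_comm] at this
  obtain rfl : v = w := le_antisymm (hle hT' hT hψ) (hle hT hT' hχ)
  refine ⟨rfl, sub_eq_zero.1 (hinf _ fun s => ?_)⟩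
  obtain ⟨f, hf, hf1⟩ := key s
  have h1 := (hT f s hf).2
  rw [(hT' f s hf).2, hf1, mul_one, mul_one] at h1
  rw [eval_sub, h1, sub_self]

end HasSymbol

/-! ### The expansions at a finite point and at infinity -/

/-- The case `ε = 1` serves the expansions at finite points, and `ε = -1` the expansion at infinity.
-/
theorem coeff_eval₂_single {ε : ℤ} (hε : ε * ε = 1) (p : ℂ[X]) (k : ℤ) :
    (p.eval₂ HahnSeries.C (HahnSeries.single ε (1 : ℂ))).coeff k =
      if 0 ≤ ε * k then p.coeff (ε * k).toNat else 0 := by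
  have h1 : ∀ i : ℕ, (HahnSeries.C (p.coeff i) * (HahnSeries.single ε (1 : ℂ)) ^ i).coeff k =
      if (i : ℤ) = ε * k then p.coeff i else 0 := by
    intro i
    rw [HahnSeries.single_pow, one_pow, HahnSeries.C_mul_eq_smul, HahnSeries.coeff_smul,
      HahnSeries.coeff_single, nsmul_eq_mul]
    have : k = (i : ℤ) * ε ↔ (i : ℤ) = ε * k := by
      constructor
      · intro h; rw [h]; linear_combination (-(i : ℤ)) * hε
      · intro h; rw [h]; linear_combination (-k) * hε
    simp [this]
  rw [eval₂_eq_sum_range, HahnSeries.coeff_sum]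
  refine (Finset.sum_congr rfl fun i _ => h1 i).trans ?_
  split_ifs with h
  · obtain ⟨j, hj⟩ := Int.eq_ofNat_of_zero_le h
    rw [hj]
    simp only [Nat.cast_inj, Finset.sum_ite_eq', Finset.mem_range, Int.toNat_natCast]
    split_ifs with h2
    · rfl
    · rw [Polynomial.coeff_eq_zero_of_natDegree_lt (by omega)]
  · exact Finset.sum_eq_zero fun i _ => if_neg (by omega)

theorem eval₂_single_injective {ε : ℤ} (hε : ε * ε = 1) :
    Function.Injective (eval₂RingHom HahnSeries.C (HahnSeries.single ε (1 : ℂ))) := by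
  rw [injective_iff_map_eq_zero]
  intro p hp
  ext i
  have h := coeff_eval₂_single hε p (ε * i)
  rw [coe_eval₂RingHom] at hp
  rw [hp, HahnSeries.coeff_zero, ← mul_assoc, hε, one_mul, if_pos (by omega)] at h
  simpa using h.symm

/-- The expansion of rational functions in `t = z - p`. -/
def expandAt (p : ℂ) : RatFunc ℂ →+* LaurentSeries ℂ :=
  RatFunc.liftRingHom ((eval₂RingHom HahnSeries.C (HahnSeries.single 1 (1 : ℂ))).comp
      (taylorAlgHom p : ℂ[X] →+* ℂ[X]))
    (nonZeroDivisors_le_comap_nonZeroDivisors_of_injective _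
      (by
        rw [RingHom.coe_comp]
        exact (eval₂_single_injective (one_mul 1)).comp (taylor_injective p)))

/-- The expansion of rational functions in `t = 1 / z`. -/
def expandAtInfty : RatFunc ℂ →+* LaurentSeries ℂ :=
  RatFunc.liftRingHom (eval₂RingHom HahnSeries.C (HahnSeries.single (-1) (1 : ℂ)))
    (nonZeroDivisors_le_comap_nonZeroDivisors_of_injective _
      (eval₂_single_injective (by norm_num)))

theorem expandAt_algebraMap (p : ℂ) (f : ℂ[X]) :
    expandAt p (algebraMap ℂ[X] (RatFunc ℂ) f) =
      (taylor p f).eval₂ HahnSeries.C (HahnSeries.single 1 (1 : ℂ)) :=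
  RatFunc.liftRingHom_algebraMap _ _ _

theorem expandAtInfty_algebraMap (f : ℂ[X]) :
    expandAtInfty (algebraMap ℂ[X] (RatFunc ℂ) f) =
      f.eval₂ HahnSeries.C (HahnSeries.single (-1) (1 : ℂ)) :=
  RatFunc.liftRingHom_algebraMap _ _ _

theorem algebraMap_ratFunc_eq (c : ℂ) :
    algebraMap ℂ (RatFunc ℂ) c = algebraMap ℂ[X] (RatFunc ℂ) (C c) := by
  rw [IsScalarTower.algebraMap_apply ℂ ℂ[X] (RatFunc ℂ), Polynomial.algebraMap_eq]

theorem expandAt_algebraMap_complex (p c : ℂ) :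
    expandAt p (algebraMap ℂ (RatFunc ℂ) c) = HahnSeries.C c := by
  rw [algebraMap_ratFunc_eq, expandAt_algebraMap, taylor_C, eval₂_C]

theorem expandAtInfty_algebraMap_complex (c : ℂ) :
    expandAtInfty (algebraMap ℂ (RatFunc ℂ) c) = HahnSeries.C c := by
  rw [algebraMap_ratFunc_eq, expandAtInfty_algebraMap, eval₂_C]

theorem expandAt_X (p : ℂ) :
    expandAt p RatFunc.X = HahnSeries.single 1 1 + HahnSeries.C p := by
  rw [← RatFunc.algebraMap_X, expandAt_algebraMap, taylor_X, eval₂_add, eval₂_X, eval₂_C]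

theorem expandAtInfty_X : expandAtInfty RatFunc.X = HahnSeries.single (-1) 1 := by
  rw [← RatFunc.algebraMap_X, expandAtInfty_algebraMap, eval₂_X]

theorem exists_expandAt_eq_single (p : ℂ) :
    ∃ t, expandAt p t = HahnSeries.single 1 1 :=
  ⟨RatFunc.X - algebraMap ℂ _ p, by
    rw [map_sub, expandAt_X, expandAt_algebraMap_complex, add_sub_cancel_right]⟩

theorem exists_expandAtInfty_eq_single :
    ∃ t, expandAtInfty t = HahnSeries.single 1 1 :=
  ⟨RatFunc.X⁻¹, by rw [map_inv₀, expandAtInfty_X, HahnSeries.inv_single, neg_neg, inv_one]⟩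

theorem vanishBelow_expandAt_algebraMap (p : ℂ) (f : ℂ[X]) :
    VanishBelow 0 (expandAt p (algebraMap ℂ[X] (RatFunc ℂ) f)) := fun k hk => by
  rw [expandAt_algebraMap, coeff_eval₂_single (one_mul 1), if_neg (by omega)]

theorem coeff_zero_expandAt_algebraMap (p : ℂ) (f : ℂ[X]) :
    (expandAt p (algebraMap ℂ[X] (RatFunc ℂ) f)).coeff 0 = f.eval p := by
  rw [expandAt_algebraMap, coeff_eval₂_single (one_mul 1), if_pos (by omega)]
  simp [taylor_coeff_zero]

theorem coeff_one_expandAt_algebraMap (p : ℂ) (f : ℂ[X]) :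
    (expandAt p (algebraMap ℂ[X] (RatFunc ℂ) f)).coeff 1 = f.derivative.eval p := by
  rw [expandAt_algebraMap, coeff_eval₂_single (one_mul 1), if_pos (by omega)]
  simp [taylor_coeff_one]

theorem coeff_expandAtInfty_algebraMap (f : ℂ[X]) (k : ℕ) :
    (expandAtInfty (algebraMap ℂ[X] (RatFunc ℂ) f)).coeff (-k) = f.coeff k := by
  rw [expandAtInfty_algebraMap, coeff_eval₂_single (by norm_num), if_pos (by omega)]
  simp

theorem coeff_expandAtInfty_algebraMap_of_pos (f : ℂ[X]) {k : ℤ} (hk : 0 < k) :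
    (expandAtInfty (algebraMap ℂ[X] (RatFunc ℂ) f)).coeff k = 0 := by
  rw [expandAtInfty_algebraMap, coeff_eval₂_single (by norm_num), if_neg (by omega)]

theorem vanishBelow_expandAtInfty_algebraMap (f : ℂ[X]) :
    VanishBelow (-f.natDegree) (expandAtInfty (algebraMap ℂ[X] (RatFunc ℂ) f)) := fun k hk => by
  lift -k to ℕ using (by omega) with j hj
  rw [show k = -(j : ℤ) by omega, coeff_expandAtInfty_algebraMap,
    coeff_eq_zero_of_natDegree_lt (by omega)]

theorem eulerOp_hasSymbol_zero : HasSymbol (expandAt 0) eulerOp 0 X := by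
  have h : VanishBelow 0 (1 : LaurentSeries ℂ) := vanishBelow_single 0 1
  refine (HasSymbol.eulerOp (expandAt_algebraMap_complex 0) ?_ h).congr rfl ?_
  · rw [expandAt_X, map_zero, add_zero, laurentEuler_single]
    simp
  · simp

theorem eulerOp_hasSymbol_infty : HasSymbol expandAtInfty eulerOp 0 (-X) := by
  have h : VanishBelow 0 (HahnSeries.C (-1) : LaurentSeries ℂ) := vanishBelow_single 0 (-1)
  refine (HasSymbol.eulerOp expandAtInfty_algebraMap_complex ?_ h).congr rfl ?_
  · rw [expandAtInfty_X, laurentEuler_single, HahnSeries.C_apply, HahnSeries.single_mul_single]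
    simp
  · rw [HahnSeries.C_apply, HahnSeries.coeff_single_same]
    simp

theorem eulerOp_hasSymbol (p : ℂ) : HasSymbol (expandAt p) eulerOp (-1) (C p * X) := by
  -- With `z = t + p` one has `z d/dz = (1 + p / t) · t d/dt`.
  have h : VanishBelow (-1) (HahnSeries.single (-1) p + HahnSeries.single 0 1) :=
    (vanishBelow_single (-1) p).add ((vanishBelow_single 0 1).mono (by norm_num))
  refine (HasSymbol.eulerOp (expandAt_algebraMap_complex p) ?_ h).congr rfl ?_
  · rw [expandAt_X, laurentEuler_add, HahnSeries.C_apply, laurentEuler_single,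
      laurentEuler_single, add_mul]
    simp [HahnSeries.single_mul_single, add_comm]
  · simp

/-! ### Normal forms of differential operators -/

/-- The embedding of `ℂ(z)` into the ring of differential operators. -/
def coeffHom : RatFunc ℂ →ₐ[ℂ] diffOps :=
  mulOp.codRestrict diffOps fun f => Algebra.subset_adjoin (Or.inl ⟨f, rfl⟩)

@[simp]
theorem coeffHom_apply (f : RatFunc ℂ) : coeffHom f = coeffOp f := rfl

/-- The operator `∑ aᵢ Dⁱ` attached to the polynomial `∑ aᵢ Xⁱ`. -/
def ofPoly (p : (RatFunc ℂ)[X]) : diffOps := p.eval₂ (coeffHom : RatFunc ℂ →+* diffOps) D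

theorem ofPoly_eq_sum {p : (RatFunc ℂ)[X]} {n : ℕ} (h : p.natDegree < n) :
    ofPoly p = ∑ i ∈ Finset.range n, coeffOp (p.coeff i) * D ^ i :=
  eval₂_eq_sum_range' _ h _

theorem ofPoly_add (p q : (RatFunc ℂ)[X]) : ofPoly (p + q) = ofPoly p + ofPoly q :=
  eval₂_add _ _

theorem ofPoly_sum {α : Type*} (s : Finset α) (p : α → (RatFunc ℂ)[X]) :
    ofPoly (∑ i ∈ s, p i) = ∑ i ∈ s, ofPoly (p i) :=
  eval₂_finsetSum _ _ _ _

theorem ofPoly_monomial (i : ℕ) (a : RatFunc ℂ) : ofPoly (monomial i a) = coeffOp a * D ^ i :=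
  eval₂_monomial _ _

theorem ofPoly_C (a : RatFunc ℂ) : ofPoly (C a) = coeffOp a := eval₂_C _ _

theorem ofPoly_map (p : ℂ[X]) : ofPoly (p.map (algebraMap ℂ (RatFunc ℂ))) = aeval D p := by
  rw [ofPoly, eval₂_map, aeval_def, ← AlgHom.comp_algebraMap coeffHom]

theorem ofPoly_C_mul (a : RatFunc ℂ) (p : (RatFunc ℂ)[X]) :
    ofPoly (C a * p) = coeffOp a * ofPoly p := by
  rw [ofPoly_eq_sum (n := p.natDegree + 1) ((natDegree_C_mul_le a p).trans_lt (Nat.lt_succ_self _)),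
    ofPoly_eq_sum (Nat.lt_succ_self _), Finset.mul_sum]
  refine Finset.sum_congr rfl fun i _ => ?_
  rw [coeff_C_mul, ← mul_assoc, ← coeffHom_apply, map_mul]
  rfl

theorem D_mul_coeffOp (a : RatFunc ℂ) :
    D * coeffOp a = coeffOp a * D + coeffOp (eulerOp a) := by
  apply Subtype.ext
  apply LinearMap.ext
  intro f
  change RatFunc.X * ratDeriv (a * f) = a * (RatFunc.X * ratDeriv f) + RatFunc.X * ratDeriv a * f
  rw [ratDeriv_mul]
  ring

/-- Left multiplication by `D` on normal forms. -/
def leftD (q : (RatFunc ℂ)[X]) : (RatFunc ℂ)[X] :=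
  q * X + ∑ i ∈ Finset.range (q.natDegree + 1), monomial i (eulerOp (q.coeff i))

theorem ofPoly_leftD (q : (RatFunc ℂ)[X]) : ofPoly (leftD q) = D * ofPoly q := by
  have h : ofPoly (q * X) = ofPoly q * D := eval₂_mul_X _ _
  rw [leftD, ofPoly_add, ofPoly_sum, h, ofPoly_eq_sum (Nat.lt_succ_self _), Finset.mul_sum,
    Finset.sum_mul, ← Finset.sum_add_distrib]
  refine Finset.sum_congr rfl fun i _ => ?_
  rw [ofPoly_monomial, ← mul_assoc, D_mul_coeffOp, add_mul, mul_assoc, mul_assoc, ← pow_succ,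
    ← pow_succ']

theorem natDegree_leftD_le {q : (RatFunc ℂ)[X]} {n : ℕ} (h : q.natDegree ≤ n) :
    (leftD q).natDegree ≤ n + 1 ∧ (leftD q).coeff (n + 1) = q.coeff n := by
  have h1 : (∑ i ∈ Finset.range (q.natDegree + 1),
      monomial i (eulerOp (q.coeff i))).natDegree ≤ n := by
    refine natDegree_sum_le_of_forall_le _ _ fun i hi => (natDegree_monomial_le _).trans ?_
    rw [Finset.mem_range] at hi
    omega
  constructor
  · refine natDegree_add_le_of_degree_le ?_ (h1.trans (Nat.le_succ n))
    exact natDegree_mul_le.trans (by rw [natDegree_X]; omega)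
  · rw [leftD, coeff_add, coeff_mul_X, coeff_eq_zero_of_natDegree_lt (h1.trans_lt (Nat.lt_succ_self n)), add_zero]

theorem natDegree_leftD_iterate_le {q : (RatFunc ℂ)[X]} {n : ℕ} (h : q.natDegree ≤ n) (i : ℕ) :
    (leftD^[i] q).natDegree ≤ n + i ∧ (leftD^[i] q).coeff (n + i) = q.coeff n := by
  induction i with
  | zero => exact ⟨h, rfl⟩
  | succ i ih =>
    rw [Function.iterate_succ_apply']
    have h2 := natDegree_leftD_le ih.1
    exact ⟨h2.1, h2.2.trans ih.2⟩

theorem ofPoly_leftD_iterate (q : (RatFunc ℂ)[X]) (i : ℕ) :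
    ofPoly (leftD^[i] q) = D ^ i * ofPoly q := by
  induction i with
  | zero => simp
  | succ i ih => rw [Function.iterate_succ_apply', ofPoly_leftD, ih, ← mul_assoc, ← pow_succ']

/-- `ofPoly` is not multiplicative, but moving `D` past a coefficient only creates terms of lower
order. The orders therefore add and the leading coefficients multiply. -/
theorem exists_ofPoly_mul (p q : (RatFunc ℂ)[X]) : ∃ r, ofPoly r = ofPoly p * ofPoly q ∧
    r.natDegree ≤ p.natDegree + q.natDegree ∧
    r.coeff (p.natDegree + q.natDegree) = p.leadingCoeff * q.leadingCoeff := by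
  have h := natDegree_leftD_iterate_le (le_refl q.natDegree)
  refine ⟨∑ i ∈ Finset.range (p.natDegree + 1), C (p.coeff i) * leftD^[i] q, ?_, ?_, ?_⟩
  · rw [ofPoly_sum, ofPoly_eq_sum (p := p) (Nat.lt_succ_self _), Finset.sum_mul]
    refine Finset.sum_congr rfl fun i _ => ?_
    rw [ofPoly_C_mul, ofPoly_leftD_iterate, mul_assoc]
  · refine natDegree_sum_le_of_forall_le _ _ fun i hi => (natDegree_C_mul_le _ _).trans ?_
    have := (h i).1
    rw [Finset.mem_range] at hi
    omega
  · rw [finsetSum_coeff, Finset.sum_range_succ, Finset.sum_eq_zero, zero_add, coeff_C_mul,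
      add_comm p.natDegree, (h _).2]
    · rfl
    · intro i hi
      have := (h i).1
      rw [Finset.mem_range] at hi
      rw [coeff_C_mul, coeff_eq_zero_of_natDegree_lt (p := leftD^[i] q) (by omega), mul_zero]

theorem ofPoly_surjective : Function.Surjective ofPoly := by
  rintro ⟨T, hT⟩
  suffices h : ∃ p, (ofPoly p : Module.End ℂ (RatFunc ℂ)) = T by
    obtain ⟨p, hp⟩ := h
    exact ⟨p, Subtype.ext hp⟩
  induction hT using Algebra.adjoin_induction with
  | mem x hx =>
    rcases hx with ⟨f, rfl⟩ | rfl
    · exact ⟨C f, by rw [ofPoly_C]; rfl⟩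
    · exact ⟨X, by rw [ofPoly, eval₂_X]; rfl⟩
  | algebraMap c =>
    refine ⟨C (algebraMap ℂ _ c), ?_⟩
    rw [ofPoly_C, ← coeffHom_apply, AlgHom.commutes]
    rfl
  | add x y _ _ hx hy =>
    obtain ⟨p, rfl⟩ := hx
    obtain ⟨q, rfl⟩ := hy
    exact ⟨p + q, by rw [ofPoly_add]; rfl⟩
  | mul x y _ _ hx hy =>
    obtain ⟨p, rfl⟩ := hx
    obtain ⟨q, rfl⟩ := hy
    obtain ⟨r, hr, -⟩ := exists_ofPoly_mul p q
    exact ⟨r, by rw [hr]; rfl⟩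

/-- Since `D z ^ s = s z ^ s`, the operator recovers the values of `p` at all natural numbers.
Normal forms are therefore unique. -/
theorem ofPoly_apply_X_pow (p : (RatFunc ℂ)[X]) (s : ℕ) :
    (ofPoly p : Module.End ℂ (RatFunc ℂ)) (RatFunc.X ^ s) =
      p.eval (s : RatFunc ℂ) * RatFunc.X ^ s := by
  have h1 : eulerOp (RatFunc.X ^ s) = (s : RatFunc ℂ) * RatFunc.X ^ s := by
    change RatFunc.X * ratDeriv (RatFunc.X ^ s) = _
    rw [← RatFunc.algebraMap_X, ← map_pow, ratDeriv_algebraMap, derivative_X_pow, ← map_mul]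
    cases s with
    | zero => simp
    | succ s => simp [pow_succ]; ring
  have h2 : ∀ i : ℕ, (eulerOp ^ i) (RatFunc.X ^ s) = (s : RatFunc ℂ) ^ i * RatFunc.X ^ s := by
    intro i
    induction i with
    | zero => simp
    | succ i ih =>
      rw [pow_succ', Module.End.mul_apply, ih, ← Nat.cast_pow, ← nsmul_eq_mul, map_nsmul, h1,
        nsmul_eq_mul]
      push_cast
      ring
  rw [ofPoly_eq_sum (Nat.lt_succ_self _), AddSubmonoidClass.coe_finsetSum,
    LinearMap.sum_apply, eval_eq_sum_range, Finset.sum_mul]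
  refine Finset.sum_congr rfl fun i _ => ?_
  rw [mul_assoc, ← h2]
  rfl

theorem ofPoly_injective : Function.Injective ofPoly := by
  intro p q h
  refine sub_eq_zero.1 (Polynomial.eq_zero_of_infinite_isRoot _
    ((Set.infinite_range_of_injective (Nat.cast_injective (R := RatFunc ℂ))).mono ?_))
  rintro _ ⟨s, rfl⟩
  have h1 := ofPoly_apply_X_pow p s
  rw [h, ofPoly_apply_X_pow q s] at h1
  have h2 := mul_right_cancel₀ (pow_ne_zero s RatFunc.X_ne_zero) h1
  rw [Set.mem_ofPred_eq, IsRoot.def, eval_sub, h2, sub_self]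

theorem hasOrder_iff {P : diffOps} {n : ℕ} :
    HasOrder P n ↔ ∃ p, p ≠ 0 ∧ p.natDegree = n ∧ ofPoly p = P := by
  constructor
  · rintro ⟨a, ha, rfl⟩
    have hc : (∑ i ∈ Finset.range (n + 1), monomial i (a i)).coeff n ≠ 0 := by
      simpa [finsetSum_coeff, coeff_monomial] using ha
    refine ⟨∑ i ∈ Finset.range (n + 1), monomial i (a i), ?_, ?_, ?_⟩
    · intro h
      rw [h] at hc
      exact hc rfl
    · refine le_antisymm (natDegree_sum_le_of_forall_le _ _ fun i hi =>
        (natDegree_monomial_le _).trans ?_) (le_natDegree_of_ne_zero hc)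
      rw [Finset.mem_range] at hi
      omega
    · rw [ofPoly_sum]
      exact Finset.sum_congr rfl fun i _ => ofPoly_monomial i (a i)
  · rintro ⟨p, hp, rfl, rfl⟩
    exact ⟨p.coeff, leadingCoeff_ne_zero.2 hp, ofPoly_eq_sum (Nat.lt_succ_self _)⟩

theorem HasOrder.unique {P : diffOps} {m n : ℕ} (hm : HasOrder P m) (hn : HasOrder P n) :
    m = n := by
  obtain ⟨p, -, rfl, hp⟩ := hasOrder_iff.1 hm
  obtain ⟨q, -, rfl, rfl⟩ := hasOrder_iff.1 hn
  rw [ofPoly_injective hp]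

theorem HasOrder.ne_zero {P : diffOps} {n : ℕ} (h : HasOrder P n) : P ≠ 0 := by
  obtain ⟨p, hp, -, rfl⟩ := hasOrder_iff.1 h
  exact fun h0 => hp (ofPoly_injective (h0.trans (eval₂_zero _ _).symm))

theorem HasOrder.mul {P Q : diffOps} {m n : ℕ} (hP : HasOrder P m) (hQ : HasOrder Q n) :
    HasOrder (P * Q) (m + n) := by
  obtain ⟨p, hp, rfl, rfl⟩ := hasOrder_iff.1 hP
  obtain ⟨q, hq, rfl, rfl⟩ := hasOrder_iff.1 hQ
  obtain ⟨r, hr, hle, hc⟩ := exists_ofPoly_mul p q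
  have hc' : r.coeff (p.natDegree + q.natDegree) ≠ 0 := by
    rw [hc]
    exact mul_ne_zero (leadingCoeff_ne_zero.2 hp) (leadingCoeff_ne_zero.2 hq)
  refine hasOrder_iff.2 ⟨r, ?_, le_antisymm hle (le_natDegree_of_ne_zero hc'), hr⟩
  rintro rfl
  exact hc' rfl

theorem exists_hasOrder {P : diffOps} (hP : P ≠ 0) : ∃ n, HasOrder P n := by
  obtain ⟨p, rfl⟩ := ofPoly_surjective P
  refine ⟨p.natDegree, hasOrder_iff.2 ⟨p, ?_, rfl, rfl⟩⟩
  rintro rfl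
  exact hP (eval₂_zero _ _)

theorem hasOrder_coeffOp {a : RatFunc ℂ} (ha : a ≠ 0) : HasOrder (coeffOp a) 0 :=
  hasOrder_iff.2 ⟨C a, C_ne_zero.2 ha, natDegree_C a, ofPoly_C a⟩

theorem isUnit_coeffOp {a : RatFunc ℂ} (ha : a ≠ 0) : IsUnit (coeffOp a) :=
  (isUnit_iff_ne_zero.2 ha).map coeffHom

theorem HasOrder.isUnit {P : diffOps} (h : HasOrder P 0) : IsUnit P := by
  obtain ⟨p, hp, hd, rfl⟩ := hasOrder_iff.1 h
  rw [eq_C_of_natDegree_eq_zero hd] at hp ⊢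
  rw [ofPoly_C]
  exact isUnit_coeffOp (C_ne_zero.1 hp)

theorem HasOrder.eq_zero_of_isUnit {P : diffOps} {n : ℕ} (h : HasOrder P n) (hu : IsUnit P) :
    n = 0 := by
  obtain ⟨u, rfl⟩ := hu
  have h1 : HasOrder (1 : diffOps) 0 := by
    simpa [← coeffHom_apply] using hasOrder_coeffOp (one_ne_zero (α := RatFunc ℂ))
  have hne : ((u⁻¹ : diffOpsˣ) : diffOps) ≠ 0 := by
    intro h0
    have := u.mul_inv
    rw [h0, mul_zero] at this
    have h2 := congrArg (fun T : diffOps => (T : Module.End ℂ (RatFunc ℂ)) 1) this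
    exact zero_ne_one h2
  obtain ⟨m, hm⟩ := exists_hasOrder hne
  have h2 := h.mul hm
  rw [u.mul_inv] at h2
  have := h2.unique h1
  omega

/-! ### The operator `L` -/

theorem L_eq : L = coeffOp (1 - 729 * RatFunc.X) * D ^ 4 + coeffOp (-(729 * RatFunc.X)) *
    aeval D (C 2 * X ^ 3 + (C (13 / 9) * X ^ 2 + C (4 / 9) * X + C (4 / 81)) : ℂ[X]) := by
  have h : (D + algebraMap ℂ diffOps (1 / 3)) ^ 2 * (D + algebraMap ℂ diffOps (2 / 3)) ^ 2 =
      D ^ 4 + aeval D (C 2 * X ^ 3 + (C (13 / 9) * X ^ 2 + C (4 / 9) * X + C (4 / 81)) : ℂ[X]) := by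
    have h1 : ((X + C (1 / 3)) ^ 2 * (X + C (2 / 3)) ^ 2 : ℂ[X]) =
        X ^ 4 + (C 2 * X ^ 3 + (C (13 / 9) * X ^ 2 + C (4 / 9) * X + C (4 / 81))) := by
      refine Polynomial.funext fun x => ?_
      simp only [eval_mul, eval_pow, eval_add, eval_X, eval_C]
      ring
    have h2 := congrArg (aeval D) h1
    rwa [map_mul, map_pow, map_pow, map_add, map_add, aeval_X, aeval_C, aeval_C, map_add, map_pow,
      aeval_X] at h2
  have h3 : (3 : RatFunc ℂ) ^ 6 = 729 := by norm_num
  have hneg : ∀ (a : RatFunc ℂ) (T : diffOps), coeffOp (-a) * T = -(coeffOp a * T) := fun a T =>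
    Subtype.ext (LinearMap.ext fun f => neg_mul a ((T : Module.End ℂ (RatFunc ℂ)) f))
  have hsub : ∀ (a : RatFunc ℂ) (T : diffOps), coeffOp (1 - a) * T = T - coeffOp a * T :=
    fun a T => Subtype.ext (LinearMap.ext fun f =>
      one_sub_mul a ((T : Module.End ℂ (RatFunc ℂ)) f))
  rw [L, mul_assoc, h, h3, hneg, hsub, mul_add, sub_add_eq_sub_sub, ← sub_eq_add_neg]

theorem hasOrder_L : HasOrder L 4 := by
  set R : ℂ[X] := C 2 * X ^ 3 + (C (13 / 9) * X ^ 2 + C (4 / 9) * X + C (4 / 81)) with hR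
  have hRd : R.natDegree ≤ 3 := by rw [hR]; compute_degree
  have hd : ((R.map (algebraMap ℂ (RatFunc ℂ)))).natDegree < 4 :=
    (natDegree_map_le.trans hRd).trans_lt (by norm_num)
  have hne : (1 - 729 * RatFunc.X : RatFunc ℂ) ≠ 0 := by
    intro h
    have h1 : expandAt 0 (1 - 729 * RatFunc.X) = 0 := by rw [h, map_zero]
    have h2 : (729 : RatFunc ℂ) = algebraMap ℂ _ 729 := (map_ofNat _ 729).symm
    have h3 := congrArg (fun x => HahnSeries.coeff x 0) h1
    rw [map_sub, map_mul, map_one, h2, expandAt_algebraMap_complex, expandAt_X,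
      HahnSeries.C_mul_eq_smul] at h3
    simp at h3
  set p : (RatFunc ℂ)[X] := C (1 - 729 * RatFunc.X) * X ^ 4 +
    C (-(729 * RatFunc.X)) * R.map (algebraMap ℂ (RatFunc ℂ)) with hp
  have hc : p.coeff 4 ≠ 0 := by
    rw [hp, coeff_add, coeff_C_mul, coeff_C_mul, coeff_X_pow_self,
      coeff_eq_zero_of_natDegree_lt hd, mul_one, mul_zero, add_zero]
    exact hne
  have hX : ofPoly (X ^ 4) = D ^ 4 := eval₂_X_pow _ _
  refine hasOrder_iff.2 ⟨p, fun h => hc (by rw [h, coeff_zero]),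
    le_antisymm ?_ (le_natDegree_of_ne_zero hc), ?_⟩
  · refine natDegree_add_le_of_degree_le ?_ ((natDegree_C_mul_le _ _).trans hd.le)
    exact (natDegree_C_mul_le _ _).trans (natDegree_X_pow_le 4)
  · rw [hp, ofPoly_add, ofPoly_C_mul, ofPoly_C_mul, ofPoly_map, hX, L_eq]

/-! ### Symbols of operators in normal form -/

/-- The symbol of `Dⁱ` at a place where `D` has the symbol `a X` in degree `δ`. -/
def eulerSymbol (δ : ℤ) (a : ℂ) : ℕ → ℂ[X]
  | 0 => 1
  | i + 1 => C a * (X + C ((i * δ : ℤ) : ℂ)) * eulerSymbol δ a i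

theorem eulerSymbol_coeff (δ : ℤ) (a : ℂ) (i : ℕ) :
    (eulerSymbol δ a i).natDegree ≤ i ∧ (eulerSymbol δ a i).coeff i = a ^ i := by
  induction i with
  | zero => simp [eulerSymbol]
  | succ i ih =>
    rw [eulerSymbol, mul_assoc]
    constructor
    · refine (natDegree_C_mul_le _ _).trans (natDegree_mul_le.trans ?_)
      rw [natDegree_X_add_C]
      omega
    · rw [coeff_C_mul, add_mul, coeff_add, coeff_X_mul, ih.2, coeff_C_mul,
        coeff_eq_zero_of_natDegree_lt (Nat.lt_succ_of_le ih.1), mul_zero, add_zero, pow_succ']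

theorem eulerSymbol_coeff_pred (δ : ℤ) (a : ℂ) (i : ℕ) :
    (eulerSymbol δ a (i + 1)).coeff i = a ^ (i + 1) * (δ * (i * (i + 1) / 2)) := by
  induction i with
  | zero => simp [eulerSymbol]
  | succ i ih =>
    rw [eulerSymbol, mul_assoc, coeff_C_mul, add_mul, coeff_add, coeff_X_mul, ih, coeff_C_mul,
      (eulerSymbol_coeff δ a (i + 1)).2]
    push_cast
    ring

/-- The `i`-th symbol has exact degree `i`, so the family is linearly independent. The leading
contributions of different powers of `D` therefore cannot cancel. -/
theorem sum_eulerSymbol_eq_zero {δ : ℤ} {a : ℂ} (ha : a ≠ 0) (c : ℕ → ℂ) (n : ℕ)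
    (h : ∑ i ∈ Finset.range n, C (c i) * eulerSymbol δ a i = 0) : ∀ i < n, c i = 0 := by
  induction n with
  | zero => simp
  | succ n ih =>
    have hn : c n = 0 := by
      have h1 := congrArg (fun p => coeff p n) h
      simp only [finsetSum_coeff, coeff_C_mul, coeff_zero] at h1
      rw [Finset.sum_range_succ, Finset.sum_eq_zero, zero_add, (eulerSymbol_coeff δ a n).2] at h1
      · exact (mul_eq_zero.1 h1).resolve_right (pow_ne_zero n ha)
      · intro i hi
        rw [Finset.mem_range] at hi
        rw [coeff_eq_zero_of_natDegree_lt ((eulerSymbol_coeff δ a i).1.trans_lt hi), mul_zero]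
    rw [Finset.sum_range_succ, hn, C_0, zero_mul, add_zero] at h
    intro i hi
    rcases Nat.lt_succ_iff_lt_or_eq.1 hi with h' | rfl
    · exact ih h i h'
    · exact hn

section Local

variable {ι : RatFunc ℂ →+* LaurentSeries ℂ} {δ : ℤ} {a : ℂ}

theorem HasSymbol.eulerOp_pow (hD : HasSymbol ι PicardFuchs.eulerOp δ (C a * X)) (i : ℕ) :
    HasSymbol ι (PicardFuchs.eulerOp ^ i) (i * δ) (eulerSymbol δ a i) := by
  induction i with
  | zero => exact HasSymbol.one.congr (by simp) rfl
  | succ i ih =>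
    rw [pow_succ']
    refine (hD.mul ih).congr (by push_cast; ring) ?_
    rw [eulerSymbol, mul_comp, C_comp, X_comp]

theorem exists_symbol_ofPoly (hD : HasSymbol ι eulerOp δ (C a * X)) (ha : a ≠ 0)
    {p : (RatFunc ℂ)[X]} (hp : p ≠ 0) :
    ∃ v, (∀ i : ℕ, VanishBelow (v - i * δ) (ι (p.coeff i))) ∧
      (∑ i ∈ Finset.range (p.natDegree + 1),
        C ((ι (p.coeff i)).coeff (v - i * δ)) * eulerSymbol δ a i) ≠ 0 ∧
      HasSymbol ι (ofPoly p : Module.End ℂ (RatFunc ℂ)) v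
        (∑ i ∈ Finset.range (p.natDegree + 1),
          C ((ι (p.coeff i)).coeff (v - i * δ)) * eulerSymbol δ a i) := by
  -- The degree of the symbol is the least of `ord aᵢ + i δ`. The minimum runs over the support
  -- only, because the zero series has order 0 by convention.
  obtain ⟨j, hj, hmin⟩ := Finset.exists_min_image p.support
    (fun i => (ι (p.coeff i)).order + i * δ) (Polynomial.support_nonempty.2 hp)
  set v : ℤ := (ι (p.coeff j)).order + j * δ with hv
  have hvan : ∀ i : ℕ, VanishBelow (v - i * δ) (ι (p.coeff i)) := by
    intro i
    by_cases hi : i ∈ p.support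
    · have := hmin i hi
      exact (vanishBelow_order _).mono (by linarith)
    · rw [notMem_support_iff.1 hi, map_zero]
      exact fun k _ => rfl
  refine ⟨v, hvan, fun h => ?_, ?_⟩
  · have h1 := sum_eulerSymbol_eq_zero ha _ _ h j (Nat.lt_succ_of_le (le_natDegree_of_mem_supp j hj))
    rw [hv, add_sub_cancel_right, HahnSeries.coeff_order_eq_zero, map_eq_zero] at h1
    exact mem_support_iff.1 hj h1
  · rw [ofPoly_eq_sum (Nat.lt_succ_self _), AddSubmonoidClass.coe_finsetSum]
    refine HasSymbol.sum _ _ _ fun i _ => ?_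
    refine ((HasSymbol.mulOp (hvan i)).mul (hD.eulerOp_pow i)).congr (by ring) ?_
    rw [C_comp]

theorem natDegree_sum_eulerSymbol_le (c : ℕ → ℂ) (n : ℕ) :
    (∑ i ∈ Finset.range (n + 1), C (c i) * eulerSymbol δ a i).natDegree ≤ n := by
  refine natDegree_sum_le_of_forall_le _ _ fun i hi => (natDegree_C_mul_le _ _).trans ?_
  rw [Finset.mem_range] at hi
  exact (eulerSymbol_coeff δ a i).1.trans (by omega)

/-- If a product `P Q` with `Q` monic is regular singular at a place, then `Q` is regular singular
there, its exponents are among those of `P Q`, and their sum is determined by the second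
coefficient of `Q`. -/
theorem exists_exponents (hι : ∃ t, ι t = HahnSeries.single 1 1)
    (hD : HasSymbol ι eulerOp δ (C a * X)) (ha : a ≠ 0) {p q : (RatFunc ℂ)[X]} (hp : p ≠ 0)
    (hq : q.Monic) {n : ℕ} (hn : q.natDegree = n + 1) {T : Multiset ℂ} {k : ℂ} (hk : k ≠ 0) {v : ℤ}
    (hT : T.card = p.natDegree + q.natDegree)
    (hL : HasSymbol ι (ofPoly p * ofPoly q : diffOps) v (C k * (T.map fun r => X - C r).prod)) :
    VanishBelow δ (ι (q.coeff n)) ∧ ∃ S ≤ T, S.card = n + 1 ∧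
      S.sum = -(δ * (n * (n + 1) / 2)) - (ι (q.coeff n)).coeff δ / a := by
  obtain ⟨v₁, -, hne₁, h₁⟩ := exists_symbol_ofPoly hD ha hp
  obtain ⟨v₂, hvan, hne₂, h₂⟩ := exists_symbol_ofPoly hD ha hq.ne_zero
  have hd₁ := natDegree_sum_eulerSymbol_le (δ := δ) (a := a)
    (fun i => (ι (p.coeff i)).coeff (v₁ - i * δ)) p.natDegree
  have hd₂ := natDegree_sum_eulerSymbol_le (δ := δ) (a := a)
    (fun i => (ι (q.coeff i)).coeff (v₂ - i * δ)) q.natDegree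
  set χ₁ := ∑ i ∈ Finset.range (p.natDegree + 1),
    C ((ι (p.coeff i)).coeff (v₁ - i * δ)) * eulerSymbol δ a i
  set χ₂ := ∑ i ∈ Finset.range (q.natDegree + 1),
    C ((ι (q.coeff i)).coeff (v₂ - i * δ)) * eulerSymbol δ a i with hχ₂
  have hroots : (C k * (T.map fun r => X - C r).prod).roots = T := by
    rw [roots_C_mul _ hk, roots_multiset_prod_X_sub_C]
  have hdeg : (C k * (T.map fun r => X - C r).prod).natDegree = T.card := by
    rw [natDegree_C_mul hk, natDegree_multiset_prod_X_sub_C_eq_card]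
  have hne : C k * (T.map fun r => X - C r).prod ≠ 0 :=
    mul_ne_zero (C_ne_zero.2 hk) (monic_multisetProd_X_sub_C T).ne_zero
  have hcomp : χ₁.comp (X + C (v₂ : ℂ)) ≠ 0 := by
    rwa [Ne, comp_X_add_C_eq_zero_iff]
  have heq := (hL.unique hι (h₁.mul h₂) hne (mul_ne_zero hcomp hne₂)).2
  -- Fuchs' criterion: both symbols have degree at most the order of their operator, and these
  -- bounds add up to the degree of the product, so both are equalities.
  have hdχ : χ₂.natDegree = q.natDegree := by
    have h3 := natDegree_mul hcomp hne₂
    rw [← heq, hdeg, hT, natDegree_comp, natDegree_X_add_C, mul_one] at h3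
    omega
  have hlead : χ₂.coeff (n + 1) =
      (ι 1).coeff (v₂ - (n + 1 : ℕ) * δ) * a ^ (n + 1) := by
    rw [hχ₂, hn, finsetSum_coeff, Finset.sum_range_succ, Finset.sum_eq_zero, zero_add, coeff_C_mul,
      (eulerSymbol_coeff δ a _).2, ← hn, hq.coeff_natDegree]
    intro i hi
    rw [Finset.mem_range] at hi
    rw [coeff_C_mul,
      coeff_eq_zero_of_natDegree_lt ((eulerSymbol_coeff δ a i).1.trans_lt hi), mul_zero]
  have hlead0 : χ₂.coeff (n + 1) ≠ 0 := by
    rw [← hn, ← hdχ]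
    exact leadingCoeff_ne_zero.2 hne₂
  -- The top coefficient of `χ₂` comes from the leading coefficient 1 of `q`, whose expansion has
  -- only a constant term. This fixes the degree `v₂`.
  have hv₂ : v₂ - (n + 1 : ℕ) * δ = 0 := by
    by_contra h
    rw [hlead, map_one, HahnSeries.coeff_one, if_neg h, zero_mul] at hlead0
    exact hlead0 rfl
  rw [hv₂, map_one, HahnSeries.coeff_one, if_pos rfl, one_mul] at hlead
  have hv₂' : v₂ - n * δ = δ := by
    push_cast at hv₂
    linarith
  have hnext : χ₂.coeff n = (ι (q.coeff n)).coeff δ * a ^ n +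
      a ^ (n + 1) * (δ * (n * (n + 1) / 2)) := by
    rw [hχ₂, hn, finsetSum_coeff, Finset.sum_range_succ, Finset.sum_range_succ,
      Finset.sum_eq_zero, zero_add, coeff_C_mul, coeff_C_mul, hv₂', hv₂,
      (eulerSymbol_coeff δ a _).2, ← hn, hq.coeff_natDegree, hn, eulerSymbol_coeff_pred, map_one,
      HahnSeries.coeff_one, if_pos rfl, one_mul]
    intro i hi
    rw [Finset.mem_range] at hi
    rw [coeff_C_mul,
      coeff_eq_zero_of_natDegree_lt ((eulerSymbol_coeff δ a i).1.trans_lt hi), mul_zero]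
  have hsplit := IsAlgClosed.splits χ₂
  refine ⟨hv₂' ▸ hvan n, χ₂.roots, ?_, ?_, ?_⟩
  · rw [← hroots]
    exact roots.le_of_dvd hne ⟨_, heq.trans (mul_comm _ _)⟩
  · rw [← hn, ← hdχ]
    exact hsplit.natDegree_eq_card_roots.symm
  -- Vieta: the second coefficient of `χ₂` combines `q.coeff n` with the second coefficient of the
  -- symbol of `D ^ (n + 1)`.
  · have h4 := hsplit.nextCoeff_eq_neg_sum_roots_mul_leadingCoeff
    rw [nextCoeff_of_natDegree_pos (by omega), leadingCoeff, hdχ, hn, hlead, Nat.add_sub_cancel,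
      hnext] at h4
    have h5 : a ^ (n + 1) ≠ 0 := pow_ne_zero _ ha
    apply mul_left_cancel₀ h5
    rw [mul_sub, pow_succ, mul_assoc (a ^ n) a (_ / a), mul_div_cancel₀ _ ha]
    linear_combination h4

end Local

/-- A lower bound for the sum over a part of a multiset. -/
theorem le_re_sum_of_le {S T : Multiset ℂ} (h : S ≤ T) (t : ℝ) :
    S.card * t - (T.map fun r => max (t - r.re) 0).sum ≤ S.sum.re := by
  obtain ⟨U, rfl⟩ := Multiset.le_iff_exists_add.1 h
  have hU : 0 ≤ (U.map fun r => max (t - r.re) 0).sum :=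
    Multiset.sum_nonneg fun x hx => by
      obtain ⟨r, -, rfl⟩ := Multiset.mem_map.1 hx
      exact le_max_right _ _
  -- Each `r` satisfies `r.re ≥ t - max (t - r.re) 0`; these inequalities are summed over `S`.
  have hS : S.card * t - (S.map fun r => max (t - r.re) 0).sum ≤ S.sum.re := by
    clear h hU
    induction S using Multiset.induction_on with
    | empty => simp
    | cons r S ih =>
      rw [Multiset.card_cons, Multiset.map_cons, Multiset.sum_cons, Multiset.sum_cons,
        Complex.add_re]
      push_cast
      have := le_max_left (t - r.re) 0
      linarith
  rw [Multiset.map_add, Multiset.sum_add]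
  linarith

/-! ### The residue theorem for simple poles -/

theorem VanishBelow.of_mul {a b : ℤ} {x y : LaurentSeries ℂ} (hx : VanishBelow a x)
    (hxa : x.coeff a ≠ 0) (h : VanishBelow (a + b) (x * y)) : VanishBelow b y := by
  by_cases hy : y = 0
  · rw [hy]; exact fun k _ => rfl
  · refine (vanishBelow_order y).mono (not_lt.1 fun hlt => ?_)
    have h1 := h (a + y.order) (by omega)
    rw [hx.coeff_mul (vanishBelow_order y)] at h1
    exact (mul_ne_zero hxa (HahnSeries.coeff_order_eq_zero.not.2 hy)) h1

/-- Simple poles make the reduced denominator `M` squarefree, and the residue at a root `p` is `N(p)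
/ M'(p)`. By Lagrange interpolation at the roots of `M`, these residues add up to the coefficient of
`N` in degree `deg M - 1`, which is the coefficient of `1 / z` at infinity. -/
theorem exists_sum_residues {g : RatFunc ℂ} (hg : ∀ p, VanishBelow (-1) (expandAt p g))
    (hinf : VanishBelow 1 (expandAtInfty g)) :
    ∃ s : Finset ℂ, (expandAtInfty g).coeff 1 = ∑ p ∈ s, (expandAt p g).coeff (-1) := by
  classical
  have hmul : algebraMap ℂ[X] (RatFunc ℂ) g.denom * g = algebraMap ℂ[X] (RatFunc ℂ) g.num := by
    nth_rw 2 [← RatFunc.num_div_denom g]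
    exact mul_div_cancel₀ _ (RatFunc.algebraMap_ne_zero g.denom_ne_zero)
  have hM : g.denom.Monic := RatFunc.monic_denom g
  set M := g.denom
  set N := g.num
  have hres : ∀ p, M.eval p = 0 →
      N.eval p = M.derivative.eval p * (expandAt p g).coeff (-1) := by
    intro p hp
    have hv : VanishBelow 1 (expandAt p (algebraMap ℂ[X] (RatFunc ℂ) M)) := by
      intro k hk
      rcases eq_or_ne k 0 with rfl | h
      · rw [coeff_zero_expandAt_algebraMap, hp]
      · exact vanishBelow_expandAt_algebraMap p M k (by omega)
    have h1 := hv.coeff_mul (hg p)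
    rw [← map_mul, hmul, coeff_one_expandAt_algebraMap] at h1
    rw [← h1, ← coeff_zero_expandAt_algebraMap]
    rfl
  -- At a multiple root of `M` the pole bound would force `N(p) = 0`, against coprimality.
  have hder : ∀ p, M.eval p = 0 → M.derivative.eval p ≠ 0 := by
    intro p hp h
    have hN := hres p hp
    rw [h, zero_mul] at hN
    obtain ⟨u, v, huv⟩ := RatFunc.isCoprime_num_denom g
    have := congrArg (eval p) huv
    rw [eval_add, eval_mul, eval_mul, hN, hp] at this
    simp at this
  have hnodup : M.roots.Nodup := by
    rw [Multiset.nodup_iff_count_le_one]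
    intro p
    rw [count_roots]
    by_contra! h
    obtain ⟨h1, h2⟩ := (one_lt_rootMultiplicity_iff_isRoot hM.ne_zero).1 h
    exact hder p h1 h2
  set s := M.roots.toFinset with hs
  have hnodal : M = Lagrange.nodal s id := by
    rw [Lagrange.nodal_eq, hs, Finset.prod, Multiset.toFinset_val, hnodup.dedup]
    have := (IsAlgClosed.splits M).eq_prod_roots_of_monic hM
    simpa using this
  have hcard : M.natDegree = s.card := by
    rw [hnodal, Lagrange.natDegree_nodal]
  have hvM := vanishBelow_expandAtInfty_algebraMap M
  have hNinf := hvM.mul hinf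
  have hNc := hvM.coeff_mul hinf
  rw [← map_mul, hmul] at hNinf hNc
  rw [coeff_expandAtInfty_algebraMap, hM.coeff_natDegree, one_mul] at hNc
  have hdeg : N.degree < s.card := by
    rw [degree_lt_iff_coeff_zero]
    intro k hk
    rw [← coeff_expandAtInfty_algebraMap]
    exact hNinf _ (by rw [hcard]; omega)
  refine ⟨s, ?_⟩
  rw [← hNc]
  -- Without poles the index `s.card - 1` would be truncated, so this case is separate.
  rcases Nat.eq_zero_or_pos s.card with h0 | hpos
  · rw [Finset.card_eq_zero.1 h0, Finset.sum_empty, hcard, h0]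
    exact coeff_expandAtInfty_algebraMap_of_pos N (by norm_num)
  · have h1 := coeff_expandAtInfty_algebraMap N (s.card - 1)
    rw [show (-((s.card - 1 : ℕ) : ℤ)) = -(M.natDegree : ℤ) + 1 by rw [hcard]; omega] at h1
    rw [h1, Lagrange.coeff_eq_sum (v := id) (Function.injective_id.injOn) hdeg]
    refine Finset.sum_congr rfl fun p hp => ?_
    have hp0 : M.eval p = 0 := by
      rw [hs, Multiset.mem_toFinset] at hp
      exact isRoot_of_mem_roots hp
    have h2 : M.derivative.eval p = ∏ j ∈ s.erase p, (id p - id j) := by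
      rw [hnodal, ← Lagrange.eval_nodal]
      exact Lagrange.eval_nodal_derivative_eval_node_eq (v := id) hp
    rw [← h2]
    rw [id, hres p hp0, mul_div_cancel_left₀ _ (hder p hp0)]

/-- The residue theorem for the differential `f dz / z`. -/
theorem exists_sum_residues_div {f : RatFunc ℂ} (h0 : VanishBelow 0 (expandAt 0 f))
    (h0' : (expandAt 0 f).coeff 0 = 0) (hf : ∀ p ≠ 0, VanishBelow (-1) (expandAt p f))
    (hinf : VanishBelow 0 (expandAtInfty f)) :
    ∃ s : Finset ℂ, 0 ∉ s ∧
      (expandAtInfty f).coeff 0 = ∑ p ∈ s, (expandAt p f).coeff (-1) / p := by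
  set g := RatFunc.X⁻¹ * f
  have hfg : f = RatFunc.X * g := (mul_inv_cancel_left₀ RatFunc.X_ne_zero f).symm
  have hX0 : VanishBelow 1 (expandAt 0 RatFunc.X) := by
    rw [expandAt_X, map_zero, add_zero]
    exact vanishBelow_single 1 1
  have hX0' : (expandAt 0 RatFunc.X).coeff 1 = 1 := by
    rw [expandAt_X, map_zero, add_zero, HahnSeries.coeff_single_same]
  have hXp : ∀ p, VanishBelow 0 (expandAt p RatFunc.X) := fun p => by
    rw [← RatFunc.algebraMap_X]
    exact vanishBelow_expandAt_algebraMap p X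
  have hXp' : ∀ p, (expandAt p RatFunc.X).coeff 0 = p := fun p => by
    rw [← RatFunc.algebraMap_X, coeff_zero_expandAt_algebraMap, eval_X]
  have hXi : VanishBelow (-1) (expandAtInfty RatFunc.X) := by
    rw [expandAtInfty_X]
    exact vanishBelow_single (-1) 1
  have hXi' : (expandAtInfty RatFunc.X).coeff (-1) = 1 := by
    rw [expandAtInfty_X, HahnSeries.coeff_single_same]
  rw [hfg, map_mul] at h0 h0' hinf
  have hg0 : VanishBelow (-1) (expandAt 0 g) :=
    hX0.of_mul (by rw [hX0']; exact one_ne_zero) (by simpa using h0)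
  have hg : ∀ p, VanishBelow (-1) (expandAt p g) := by
    intro p
    rcases eq_or_ne p 0 with rfl | hp
    · exact hg0
    · refine (hXp p).of_mul (by rwa [hXp']) ?_
      rw [← map_mul, ← hfg]
      simpa using hf p hp
  have hgi : VanishBelow 1 (expandAtInfty g) :=
    hXi.of_mul (by rw [hXi']; exact one_ne_zero) (by simpa using hinf)
  have hr0 : (expandAt 0 g).coeff (-1) = 0 := by
    have := hX0.coeff_mul hg0
    rw [hX0', one_mul] at this
    rw [← this]
    exact h0'
  have hrp : ∀ p ≠ 0, (expandAt p g).coeff (-1) = (expandAt p f).coeff (-1) / p := by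
    intro p hp
    have := (hXp p).coeff_mul (hg p)
    rw [← map_mul, ← hfg, hXp', zero_add] at this
    rw [this, mul_div_cancel_left₀ _ hp]
  have hri : (expandAtInfty g).coeff 1 = (expandAtInfty f).coeff 0 := by
    have := hXi.coeff_mul hgi
    rw [← map_mul, ← hfg, hXi', one_mul] at this
    exact this.symm
  obtain ⟨s, hs⟩ := exists_sum_residues hg hgi
  -- `f` vanishes at 0, so `f / z` has residue 0 there and the point can be dropped.
  refine ⟨s.erase 0, Finset.notMem_erase 0 s, ?_⟩
  rw [← hri, hs, ← Finset.sum_erase s hr0]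
  exact Finset.sum_congr rfl fun p hp => hrp p (Finset.ne_of_mem_erase hp)

/-! ### The local exponents of `L` -/

theorem HasSymbol.aeval_eulerOp {ι : RatFunc ℂ →+* LaurentSeries ℂ} {a : ℂ}
    (hι : ∀ c, ι (algebraMap ℂ _ c) = HahnSeries.C c)
    (hD : HasSymbol ι PicardFuchs.eulerOp 0 (C a * X)) (r : ℂ[X]) :
    HasSymbol ι (aeval PicardFuchs.eulerOp r) 0 (r.comp (C a * X)) := by
  induction r using Polynomial.induction_on with
  | C c =>
    rw [aeval_C, C_comp]
    exact HasSymbol.const hι c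
  | add p q hp hq =>
    rw [map_add, add_comp]
    exact hp.add hq
  | monomial n c ih =>
    rw [pow_succ, ← mul_assoc, map_mul, aeval_X, mul_comp, X_comp]
    refine (ih.mul hD).congr (by norm_num) ?_
    simp

/-- Here `D ^ i` lowers the order by `i`, so only the term of degree `d` contributes in degree `-d`.
-/
theorem HasSymbol.aeval_eulerOp_of_natDegree_le {ι : RatFunc ℂ →+* LaurentSeries ℂ} {a : ℂ}
    (hι : ∀ c, ι (algebraMap ℂ _ c) = HahnSeries.C c)
    (hD : HasSymbol ι PicardFuchs.eulerOp (-1) (C a * X)) {r : ℂ[X]} {d : ℕ}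
    (hr : r.natDegree ≤ d) :
    HasSymbol ι (aeval PicardFuchs.eulerOp r) (-d) (C (r.coeff d) * eulerSymbol (-1) a d) := by
  have h : ∀ i : ℕ, HasSymbol ι (algebraMap ℂ _ (r.coeff i) * PicardFuchs.eulerOp ^ i) (-i)
      (C (r.coeff i) * eulerSymbol (-1) a i) := fun i =>
    ((HasSymbol.const hι (r.coeff i)).mul (hD.eulerOp_pow i)).congr (by ring) (by rw [C_comp])
  have h2 : HasSymbol ι (∑ i ∈ Finset.range d,
      algebraMap ℂ (Module.End ℂ (RatFunc ℂ)) (r.coeff i) * PicardFuchs.eulerOp ^ i) (-d)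
      (∑ i ∈ Finset.range d, 0) := by
    refine HasSymbol.sum _ _ _ fun i hi => (h i).lower ?_
    rw [Finset.mem_range] at hi
    omega
  have h3 := h2.add (h d)
  rw [← Finset.sum_range_succ, Finset.sum_const_zero, zero_add] at h3
  rwa [aeval_def, eval₂_eq_sum_range' _ (Nat.lt_succ_of_le hr)]

theorem HasSymbol.mulOp_algebraMap (p : ℂ) (f : ℂ[X]) :
    HasSymbol (expandAt p) (PicardFuchs.mulOp (algebraMap ℂ[X] (RatFunc ℂ) f)) 0
      (C (f.eval p)) := by
  rw [← coeff_zero_expandAt_algebraMap]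
  exact HasSymbol.mulOp (vanishBelow_expandAt_algebraMap p f)

theorem HasSymbol.mulOp_algebraMap_of_root {p : ℂ} {f : ℂ[X]} (h : f.eval p = 0) :
    HasSymbol (expandAt p) (PicardFuchs.mulOp (algebraMap ℂ[X] (RatFunc ℂ) f)) 1
      (C (f.derivative.eval p)) := by
  rw [← coeff_one_expandAt_algebraMap]
  refine HasSymbol.mulOp fun k hk => ?_
  rcases eq_or_ne k 0 with rfl | h'
  · rw [coeff_zero_expandAt_algebraMap, h]
  · exact vanishBelow_expandAt_algebraMap p f k (by omega)

theorem HasSymbol.mulOp_algebraMap_infty {f : ℂ[X]} (h : f.natDegree ≤ 1) :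
    HasSymbol expandAtInfty (PicardFuchs.mulOp (algebraMap ℂ[X] (RatFunc ℂ) f)) (-1)
      (C (f.coeff 1)) := by
  rw [← coeff_expandAtInfty_algebraMap]
  exact HasSymbol.mulOp ((vanishBelow_expandAtInfty_algebraMap f).mono (by omega))

/-- The part of order at most three of `(D + 1/3)² (D + 2/3)²`. -/
def lowerPart : ℂ[X] := C 2 * X ^ 3 + (C (13 / 9) * X ^ 2 + C (4 / 9) * X + C (4 / 81))

theorem natDegree_lowerPart_le : lowerPart.natDegree ≤ 3 := by
  rw [lowerPart]
  compute_degree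

theorem coeff_lowerPart : lowerPart.coeff 3 = 2 := by
  simp [lowerPart]

theorem coe_L : (L : Module.End ℂ (RatFunc ℂ)) =
    mulOp (algebraMap ℂ[X] (RatFunc ℂ) (1 - C 729 * X)) * eulerOp ^ 4 +
      mulOp (algebraMap ℂ[X] (RatFunc ℂ) (-(C 729 * X))) * aeval eulerOp lowerPart := by
  have h : algebraMap ℂ[X] (RatFunc ℂ) (C 729 * X) = 729 * RatFunc.X := by
    rw [map_mul, RatFunc.algebraMap_X, ← algebraMap_ratFunc_eq, map_ofNat]
  rw [map_sub, map_neg, map_one, h, L_eq]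
  have h2 := aeval_subalgebra_coe lowerPart diffOps D
  change _ = _ * _ + _ * aeval (D : Module.End ℂ (RatFunc ℂ)) lowerPart
  rw [← h2]
  rfl

/-- The factor `729 z` vanishes at 0, which leaves the symbol of `D ^ 4`. -/
theorem L_hasSymbol_zero :
    HasSymbol (expandAt 0) L 0
      (C 1 * ((({0, 0, 0, 0} : Multiset ℂ)).map fun r => X - C r).prod) := by
  have hD := eulerOp_hasSymbol_zero
  rw [← one_mul X, ← C_1] at hD
  rw [coe_L]
  refine (((HasSymbol.mulOp_algebraMap 0 _).mul (hD.eulerOp_pow 4)).add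
    ((HasSymbol.mulOp_algebraMap 0 _).mul
      (hD.aeval_eulerOp (expandAt_algebraMap_complex 0) _))).congr (by norm_num) ?_
  simp [eulerSymbol]

/-- The terms with the factor `z` dominate and `D` acts as `-s`, which gives `-729 (1/3 - s)² (2/3 -
s)²`. -/
theorem L_hasSymbol_infty :
    HasSymbol expandAtInfty L (-1)
      (C (-729) * ((({1 / 3, 1 / 3, 2 / 3, 2 / 3} : Multiset ℂ)).map fun r => X - C r).prod) := by
  have hD := eulerOp_hasSymbol_infty
  rw [show (-X : ℂ[X]) = C (-1) * X by simp] at hD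
  rw [coe_L]
  refine (((HasSymbol.mulOp_algebraMap_infty (by compute_degree)).mul (hD.eulerOp_pow 4)).add
    ((HasSymbol.mulOp_algebraMap_infty (by compute_degree)).mul
      (hD.aeval_eulerOp expandAtInfty_algebraMap_complex _))).congr (by norm_num) ?_
  refine Polynomial.funext fun x => ?_
  simp [eulerSymbol, lowerPart, coeff_one]
  ring

/-- Only the fourth order term reaches degree -4. For `p = 0` and `p = 1 / 729` the symbol stated
here is zero and carries no information. -/
theorem L_hasSymbol (p : ℂ) :
    HasSymbol (expandAt p) L (-4)
      (C ((1 - 729 * p) * p ^ 4) * ((({0, 1, 2, 3} : Multiset ℂ)).map fun r => X - C r).prod) := by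
  have hD := eulerOp_hasSymbol p
  rw [coe_L]
  have h1 := ((HasSymbol.mulOp_algebraMap p (1 - C 729 * X)).mul (hD.eulerOp_pow 4))
  have h2 := ((HasSymbol.mulOp_algebraMap p (-(C 729 * X))).mul
      (hD.aeval_eulerOp_of_natDegree_le (expandAt_algebraMap_complex p) natDegree_lowerPart_le))
  refine ((h1.congr (by norm_num) rfl).add (h2.lower (by norm_num))).congr rfl ?_
  refine Polynomial.funext fun x => ?_
  simp [eulerSymbol]
  ring

/-- The simple zero of `1 - 729 z` brings the terms in `D ^ 4` and `D ^ 3` to the same degree. The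
symbol is proportional to `s (s - 1) (s - 2) ((s - 3) + 2)`, where the 2 is `lowerPart.coeff 3`. -/
theorem L_hasSymbol_conifold :
    HasSymbol (expandAt (1 / 729)) L (-3)
      (C (-729 * (1 / 729) ^ 4) *
        ((({0, 1, 1, 2} : Multiset ℂ)).map fun r => X - C r).prod) := by
  have hD := eulerOp_hasSymbol (1 / 729)
  rw [coe_L]
  have h0 : (1 - C 729 * X : ℂ[X]).eval (1 / 729) = 0 := by simp
  have h1 := ((HasSymbol.mulOp_algebraMap_of_root h0).mul (hD.eulerOp_pow 4))
  have h2 := ((HasSymbol.mulOp_algebraMap (1 / 729) (-(C 729 * X))).mul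
      (hD.aeval_eulerOp_of_natDegree_le (expandAt_algebraMap_complex _) natDegree_lowerPart_le))
  rw [coeff_lowerPart] at h2
  refine ((h1.congr (by norm_num) rfl).add (h2.congr (by norm_num) rfl)).congr rfl ?_
  refine Polynomial.funext fun x => ?_
  simp [eulerSymbol]
  ring

/-! ### Irreducibility -/

theorem L_ne_ofPoly_mul_ofPoly {p q : (RatFunc ℂ)[X]} {n : ℕ} (hp : p ≠ 0) (hq : q.Monic)
    (hn : q.natDegree = n + 1) (hn2 : n ≤ 2) (hpq : p.natDegree + q.natDegree = 4) :
    ofPoly p * ofPoly q ≠ L := by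
  intro hL
  set f := q.coeff n
  have hzero : VanishBelow 0 (expandAt 0 f) ∧ (expandAt 0 f).coeff 0 = 0 := by
    have hD := eulerOp_hasSymbol_zero
    rw [← one_mul X, ← C_1] at hD
    obtain ⟨h1, S, hS, -, hsum⟩ := exists_exponents (exists_expandAt_eq_single 0) hD one_ne_zero
      hp hq hn one_ne_zero (by rw [hpq]; rfl) (hL ▸ L_hasSymbol_zero)
    have h0 : S.sum = 0 := Multiset.sum_eq_zero fun x hx => by
      simpa using Multiset.mem_of_le hS hx
    refine ⟨h1, ?_⟩
    rw [h0] at hsum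
    simpa using hsum.symm
  have hinf : VanishBelow 0 (expandAtInfty f) ∧
      ((n : ℝ) + 1) / 2 - 1 / 3 ≤ ((expandAtInfty f).coeff 0).re := by
    have hD := eulerOp_hasSymbol_infty
    rw [show (-X : ℂ[X]) = C (-1) * X by simp] at hD
    obtain ⟨h1, S, hS, hcard, hsum⟩ := exists_exponents exists_expandAtInfty_eq_single hD
      (by norm_num) hp hq hn (by norm_num) (by rw [hpq]; rfl) (hL ▸ L_hasSymbol_infty)
    -- The threshold 1/2 lies between the exponents: the two equal to 1/3 have total deficit 1/3.
    have h2 := le_re_sum_of_le hS (1 / 2)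
    refine ⟨h1, ?_⟩
    have h3 : S.sum = (expandAtInfty f).coeff 0 := by
      rw [hsum, div_neg, div_one, Int.cast_zero, zero_mul, neg_zero, sub_neg_eq_add, zero_add]
    rw [h3, hcard] at h2
    norm_num at h2
    linarith
  have hre : ∀ {S : Multiset ℂ} {P : ℂ},
      S.sum = -((-1 : ℤ) * (n * (n + 1) / 2)) - (expandAt P f).coeff (-1) / P →
      ((expandAt P f).coeff (-1) / P).re = n * (n + 1) / 2 - S.sum.re := by
    intro S P h
    have h2 : (expandAt P f).coeff (-1) / P = ((n * (n + 1) / 2 : ℝ) : ℂ) - S.sum := by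
      rw [h]
      push_cast
      ring
    rw [h2, Complex.sub_re, Complex.ofReal_re]
  have hfin : ∀ P ≠ 0, VanishBelow (-1) (expandAt P f) ∧
      ((expandAt P f).coeff (-1) / P).re ≤ if P = 1 / 729 then (n : ℝ) * (n - 1) / 2 else 0 := by
    intro P hP
    split_ifs with hc
    · subst hc
      obtain ⟨h1, S, hS, hcard, hsum⟩ := exists_exponents (exists_expandAt_eq_single (1 / 729))
        (eulerOp_hasSymbol _) hP hp hq hn (by norm_num) (by rw [hpq]; rfl)
        (hL ▸ L_hasSymbol_conifold)
      -- Among 0, 1, 1, 2 only the exponent 0 falls short of 1, so the sum is at least `n`.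
      have h2 := le_re_sum_of_le hS 1
      refine ⟨h1, ?_⟩
      rw [hre hsum]
      rw [hcard] at h2
      norm_num at h2
      linarith
    · obtain ⟨h1, S, hS, hcard, hsum⟩ := exists_exponents (exists_expandAt_eq_single P)
        (eulerOp_hasSymbol P) hP hp hq hn (mul_ne_zero (by
          contrapose! hc
          linear_combination (-1 / 729) * hc) (pow_ne_zero 4 hP)) (by rw [hpq]; rfl)
        (hL ▸ L_hasSymbol P)
      -- With threshold `n` the bound is `0 + 1 + ⋯ + n`, the least sum of `n + 1` of the exponents
      -- 0, 1, 2, 3.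
      have h2 := le_re_sum_of_le hS n
      refine ⟨h1, ?_⟩
      rw [hre hsum]
      rw [hcard] at h2
      interval_cases n <;> norm_num at h2 ⊢ <;> linarith
  obtain ⟨s, hs0, hs⟩ := exists_sum_residues_div hzero.1 hzero.2 (fun P hP => (hfin P hP).1) hinf.1
  have h3 : ((expandAtInfty f).coeff 0).re ≤
      ∑ P ∈ s, if P = 1 / 729 then (n : ℝ) * (n - 1) / 2 else 0 := by
    rw [hs, Complex.re_sum]
    exact Finset.sum_le_sum fun P hP => (hfin P fun h => hs0 (h ▸ hP)).2
  rw [Finset.sum_ite_eq'] at h3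
  have h4 := hinf.2.trans h3
  -- If 1/729 is among the poles, the inequalities for `n = 0, 1, 2` read 1/6 ≤ 0, 2/3 ≤ 0 and 7/6 ≤
  -- 1; otherwise the right side is 0.
  interval_cases n <;> split_ifs at h4 <;> norm_num at h4

theorem not_hasOrder_mul {P Q : diffOps} {m n : ℕ} (hm : 1 ≤ m) (hn : 1 ≤ n)
    (hP : HasOrder P m) (hQ : HasOrder Q n) : L ≠ P * Q := by
  intro hL
  have hmn : m + n = 4 := by
    have := hP.mul hQ
    rw [← hL] at this
    exact this.unique hasOrder_L
  obtain ⟨q, hq0, hqn, rfl⟩ := hasOrder_iff.1 hQ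
  have hb : q.leadingCoeff ≠ 0 := leadingCoeff_ne_zero.2 hq0
  -- With `b` the leading coefficient of `Q`, one writes `P Q = (P b) (b⁻¹ Q)`, so that the right
  -- factor becomes monic.
  obtain ⟨p, hp0, hpm, hp⟩ := hasOrder_iff.1 (hP.mul (hasOrder_coeffOp hb))
  have hmonic : (C q.leadingCoeff⁻¹ * q).Monic := by
    rw [Monic, leadingCoeff_mul, leadingCoeff_C, inv_mul_cancel₀ hb]
  have hdeg : (C q.leadingCoeff⁻¹ * q).natDegree = n := by
    rw [natDegree_C_mul (inv_ne_zero hb), hqn]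
  refine L_ne_ofPoly_mul_ofPoly (n := n - 1) hp0 hmonic (by omega) (by omega) (by omega) ?_
  have hinv : coeffOp q.leadingCoeff * coeffOp q.leadingCoeff⁻¹ = 1 := by
    rw [← coeffHom_apply, ← coeffHom_apply, ← map_mul, mul_inv_cancel₀ hb, map_one]
  rw [hp, ofPoly_C_mul, mul_assoc, ← mul_assoc (coeffOp _), hinv, one_mul, hL]

end PicardFuchs

end

theorem mainTheorem6 :
    Irreducible PicardFuchs.L ∧
      ¬ ∃ (P Q : PicardFuchs.diffOps) (m n : ℕ), 1 ≤ m ∧ 1 ≤ n ∧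
        PicardFuchs.HasOrder P m ∧ PicardFuchs.HasOrder Q n ∧ PicardFuchs.L = P * Q := by
  refine ⟨irreducible_iff.2 ⟨fun h => ?_, fun P Q hL => ?_⟩, ?_⟩
  · exact absurd (PicardFuchs.hasOrder_L.eq_zero_of_isUnit h) (by norm_num)
  · have hL0 : PicardFuchs.L ≠ 0 := PicardFuchs.hasOrder_L.ne_zero
    obtain ⟨m, hP⟩ := PicardFuchs.exists_hasOrder (left_ne_zero_of_mul (hL ▸ hL0))
    obtain ⟨n, hQ⟩ := PicardFuchs.exists_hasOrder (right_ne_zero_of_mul (hL ▸ hL0))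
    rcases Nat.eq_zero_or_pos m with rfl | hm
    · exact Or.inl hP.isUnit
    rcases Nat.eq_zero_or_pos n with rfl | hn
    · exact Or.inr hQ.isUnit
    exact absurd hL (PicardFuchs.not_hasOrder_mul hm hn hP hQ)
  · rintro ⟨P, Q, m, n, hm, hn, hP, hQ, hL⟩
    exact PicardFuchs.not_hasOrder_mul hm hn hP hQ hL
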